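/- Let $K$ be a field, let $\mathcal{G}$ be a simple graph with finite vertex set $V$, let $R=K[x_v : v\in V]$, let $\mathfrak m$ be the ideal of $R$ generated by the variables, and let $I(\mathcal{G})\subseteq R$ be the edge ideal of $\mathcal{G}$, generated by the monomials $x_ax_b$ with $\{a,b\}$ an edge of $\mathcal{G}$. For a monomial ideal $I\subseteq R$ with minimal set of monomial generators $G(I)$ and a total order $m_1\prec\cdots\prec m_\mu$ on $G(I)$, a symbol $u(i_1;\ldots;i_t)$ with $i_1<\cdots<i_t$ is called $L$-admissible if $m_q\nmid \mathrm{lcm}(m_{i_h},\ldots,m_{i_t})$ for all $h<t$ and all $q<i_h$. Let $L^t$ be the free $R$-module on the $L$-admissible symbols with $t$ entries ($L^0=R$). The Lyubeznik resolution of $R/I$ with respect to $\prec$ is the complex $\cdots\to L^2\to L^1\to L^0\to R/I\to 0$ with differential $$\partial\, u(i_1;\ldots;i_t)=\sum_{j=1}^t(-1)^{j+1}\frac{\mathrm{lcm}(m_{i_1},\ldots,m_{i_t})}{\mathrm{lcm}(m_{i_1},\ldots,\widehat{m_{i_j}},\ldots,m_{i_t})}\,u(i_1;\ldots;\widehat{i_j};\ldots;i_t).$$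 It is a minimal free resolution if it is exact and $\partial(L^{t+1})\subseteq\mathfrak m L^{t}$ for all $t\ge 0$. The ideal $I$ is a Lyubeznik ideal if the Lyubeznik resolution of $R/I$ is a minimal free resolution of $R/I$ for some total order on $G(I)$, and a Lyubeznik ideal $I$ is a Lyubeznik totally ideal if this holds for every total order on $G(I)$. Then: (1) If $\mathcal{G}$ has no path (with pairwise distinct vertices) of length $\ge 3$, where the length is the number of edges, then $I(\mathcal{G})$ is a Lyubeznik totally ideal. (2) If the edge set of $\mathcal{G}$ is a cycle of length $3$, that is, $\{ab,bc,ac\}$ for three distinct vertices $a,b,c$, then $I(\mathcal{G})$ is a Lyubeznik totally ideal. -/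

import Mathlib

noncomputable section

/-! Monomials of `K[x_i : i ∈ σ]` are represented by their exponent vectors `σ →₀ ℕ`:
divisibility is `≤`, the least common multiple is `⊔`, the monomial `1` is `0`, and the quotient of
a monomial by a divisor is the difference of exponent vectors. -/

section LyubeznikComplex

variable {σ ι : Type*} [LinearOrder ι]

/-- A symbol `u(i₁; …; iₜ)`, `i₁ < ⋯ < iₜ`, on the ordered family of monomials `m` is the finite set
`F = {i₁ < ⋯ < iₜ}`.  It is `L`-admissible if for every index `i_h` of `F` other than the last one,
no `m q` with `q < i_h` divides `lcm (m i_h, …, m iₜ)`. -/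
def LAdmissible (m : ι → σ →₀ ℕ) (F : Finset ι) : Prop :=
  ∀ i ∈ F, (∃ j ∈ F, i < j) → ∀ q, q < i → ¬ m q ≤ (F.filter (fun j => i ≤ j)).sup m

theorem LAdmissible.subset {m : ι → σ →₀ ℕ} {F H : Finset ι} (hF : LAdmissible m F)
    (hHF : H ⊆ F) : LAdmissible m H := by
  rintro i hi ⟨j, hj, hij⟩ q hq hle
  exact hF i (hHF hi) ⟨j, hHF hj, hij⟩ q hq
    (hle.trans (Finset.sup_mono (Finset.filter_subset_filter _ hHF)))

/-- The `L`-admissible symbols of dimension `t`. -/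
abbrev LSymbol (m : ι → σ →₀ ℕ) (t : ℕ) : Type _ :=
  {F : Finset ι // F.card = t ∧ LAdmissible m F}

/-- Deleting one entry from an `L`-admissible symbol. -/
def LSymbol.erase {m : ι → σ →₀ ℕ} {t : ℕ} (F : LSymbol m (t + 1)) (i : {i // i ∈ F.1}) :
    LSymbol m t :=
  ⟨F.1.erase i.1, by rw [Finset.card_erase_of_mem i.2, F.2.1, Nat.add_sub_cancel],
    F.2.2.subset (Finset.erase_subset _ _)⟩

/-- `Lᵗ`: the free module over the polynomial ring on the `L`-admissible symbols of dimension `t`.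
The only symbol of dimension `0` is the empty one, so `L⁰` is free of rank one. -/
abbrev LyubeznikModule (K : Type*) [Field K] (m : ι → σ →₀ ℕ) (t : ℕ) : Type _ :=
  LSymbol m t →₀ MvPolynomial σ K

/-- The differential `Lᵗ⁺¹ → Lᵗ`,
`u(F) ↦ ∑_{i ∈ F} ± (lcm F / lcm (F ∖ {i})) u(F ∖ {i})`. If `i` is the `j`-th entry of `F`
(counting from `1`), the sign is `(-1)^(j+1) = (-1)^(j-1)`, and `j - 1` is the number of entries of
`F` below `i`. -/
def lyubeznikDifferential (K : Type*) [Field K] (m : ι → σ →₀ ℕ) (t : ℕ) :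
    LyubeznikModule K m (t + 1) →ₗ[MvPolynomial σ K] LyubeznikModule K m t :=
  Finsupp.linearCombination (MvPolynomial σ K) fun F : LSymbol m (t + 1) =>
    ∑ i ∈ F.1.attach,
      Finsupp.single (F.erase i)
        (MvPolynomial.monomial (F.1.sup m - (F.1.erase i.1).sup m)
          ((-1 : K) ^ (F.1.filter (fun j => j < i.1)).card))

/-- The augmentation `L⁰ → R / I`, sending the empty symbol to `1`. -/
def lyubeznikAugmentation {K : Type*} [Field K] (m : ι → σ →₀ ℕ) (I : Ideal (MvPolynomial σ K)) :
    LyubeznikModule K m 0 →ₗ[MvPolynomial σ K] (MvPolynomial σ K ⧸ I) :=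
  Finsupp.linearCombination (MvPolynomial σ K) fun _ : LSymbol m 0 => (1 : MvPolynomial σ K ⧸ I)

end LyubeznikComplex

/-- The sequence `⋯ → L₂ → L₁ → L₀ → M → 0` is a minimal free resolution of `M` by finitely
generated modules, minimality being taken with respect to the ideal `𝔪`: the image of each
differential is contained in `𝔪 L`.  (`Function.Exact f g` says `ker g = im f`.) -/
structure IsMinimalFreeResolution {R : Type*} [CommRing R] (𝔪 : Ideal R)
    {M : Type*} [AddCommGroup M] [Module R M]
    {L : ℕ → Type*} [∀ t, AddCommGroup (L t)] [∀ t, Module R (L t)]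
    (d : ∀ t, L (t + 1) →ₗ[R] L t) (ε : L 0 →ₗ[R] M) : Prop where
  free : ∀ t, Module.Free R (L t)
  finite : ∀ t, Module.Finite R (L t)
  exact_succ : ∀ t, Function.Exact (d (t + 1)) (d t)
  exact_zero : Function.Exact (d 0) ε
  surjective : Function.Surjective ε
  minimal : ∀ t, LinearMap.range (d t) ≤ 𝔪 • (⊤ : Submodule R (L t))

section MonomialIdeals

variable {σ K : Type*} [Field K]

/-- `I` is generated by monomials. -/
def IsMonomialIdeal (I : Ideal (MvPolynomial σ K)) : Prop :=
  ∃ S : Set (σ →₀ ℕ), I = Ideal.span ((fun s => MvPolynomial.monomial s (1 : K)) '' S)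

/-- `G(I)`: the monomials of `I` that are minimal with respect to divisibility; for a monomial ideal
this is its minimal set of monomial generators. -/
def minimalGenerators (I : Ideal (MvPolynomial σ K)) : Set (σ →₀ ℕ) :=
  {s | Minimal (fun s => MvPolynomial.monomial s (1 : K) ∈ I) s}

/-- The Lyubeznik resolution of `R / I` with respect to the total order `ord` on `G(I)` is a minimal
free resolution of `R / I`; here `𝔪` is the ideal generated by the variables. -/
def LyubeznikResolutionIsMinimal (I : Ideal (MvPolynomial σ K))
    (ord : LinearOrder (minimalGenerators I)) : Prop :=
  IsMinimalFreeResolution (Ideal.span (Set.range (MvPolynomial.X : σ → MvPolynomial σ K)))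
    (@lyubeznikDifferential σ (minimalGenerators I) ord K _ Subtype.val)
    (@lyubeznikAugmentation σ (minimalGenerators I) ord K _ Subtype.val I)

/-- Lyubeznik ideals: monomial ideals for which some total order on `G(I)` gives a minimal Lyubeznik
resolution. -/
def IsLyubeznikIdeal (I : Ideal (MvPolynomial σ K)) : Prop :=
  IsMonomialIdeal I ∧ ∃ ord : LinearOrder (minimalGenerators I), LyubeznikResolutionIsMinimal I ord

/-- Lyubeznik totally ideals: Lyubeznik ideals for which every total order on `G(I)` gives a minimal
Lyubeznik resolution. -/
def IsLyubeznikTotallyIdeal (I : Ideal (MvPolynomial σ K)) : Prop :=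
  IsLyubeznikIdeal I ∧
    ∀ ord : LinearOrder (minimalGenerators I), LyubeznikResolutionIsMinimal I ord

end MonomialIdeals

/-- The edge ideal of `G` in `K[x_v : v ∈ V]`, generated by the products `x_a x_b` with `{a, b}` an
edge of `G`. -/
def edgeIdeal (K : Type*) [Field K] {V : Type*} (G : SimpleGraph V) : Ideal (MvPolynomial V K) :=
  Ideal.span {f | ∃ a b : V, G.Adj a b ∧ f = MvPolynomial.X a * MvPolynomial.X b}

end

/-! Exactness holds for every family of monomials indexed by a finite total order. In multidegree
`α` the complex is the simplicial chain complex of the admissible sets whose lcm divides `α`. If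
some generator divides `α`, this complex is a cone over the least such index `q α`
(`LAdmissible.insert`), which yields a contracting homotopy (`coneHomotopy_identity`).

Only minimality depends on the graph: no `m i` with `i` in an admissible `F` may divide the lcm of
the rest of `F` (`LAdmissible.not_le_sup_erase`). If an edge `ab` did, `F` would contain edges `ac`
and `bd` other than `ab`. Then `c ≠ d` gives a path of length 3, while `c = d` gives a triangle
inside `F`, whose least edge divides the lcm of the other two, against admissibility. A triangle
itself has too few vertices for a path of length 3, so (2) reduces to (1). -/

section Exactness

open Finset

/-- The terms for `(i, j)` and `(j, i)` cancel: removing the smaller index first lowers the position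
of the larger by one, which flips the sign. -/
theorem sum_sign_erase_erase {ι M : Type*} [LinearOrder ι] [AddCommGroup M]
    (f : Finset ι → M) (G : Finset ι) :
    ∑ i ∈ G, (-1 : ℤ) ^ (G.filter (· < i)).card •
      ∑ j ∈ G.erase i, (-1 : ℤ) ^ ((G.erase i).filter (· < j)).card • f ((G.erase i).erase j) =
      0 := by
  simp_rw [Finset.smul_sum, smul_smul]
  rw [Finset.sum_sigma' G (fun i => G.erase i) (fun i j =>
    ((-1 : ℤ) ^ (G.filter (· < i)).card * (-1 : ℤ) ^ ((G.erase i).filter (· < j)).card) •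
      f ((G.erase i).erase j))]
  have key : ∀ i ∈ G, ∀ j ∈ G, i < j →
      ((-1 : ℤ) ^ (G.filter (· < i)).card * (-1 : ℤ) ^ ((G.erase i).filter (· < j)).card) •
          f ((G.erase i).erase j) +
        ((-1 : ℤ) ^ (G.filter (· < j)).card * (-1 : ℤ) ^ ((G.erase j).filter (· < i)).card) •
          f ((G.erase j).erase i) = 0 := by
    intro i hi j hj hij
    have h1 : (G.erase j).filter (· < i) = G.filter (· < i) := by
      ext k; simp only [mem_filter, mem_erase]
      exact ⟨fun h => ⟨h.1.2, h.2⟩, fun h => ⟨⟨(h.2.trans hij).ne, h.1⟩, h.2⟩⟩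
    have h2 : (G.filter (· < j)).card = ((G.erase i).filter (· < j)).card + 1 := by
      rw [Finset.filter_erase, Finset.card_erase_add_one (by simp [hi, hij])]
    rw [h1, h2, Finset.erase_right_comm (a := j), ← add_smul]
    convert zero_smul ℤ _ using 2
    ring
  refine Finset.sum_involution (fun p _ => ⟨p.2, p.1⟩) ?_ ?_ ?_ ?_
  · rintro ⟨i, j⟩ h
    simp only [mem_sigma, mem_erase] at h
    rcases lt_or_gt_of_ne h.2.1 with hlt | hlt
    · rw [add_comm]; exact key j h.2.2 i h.1 hlt
    · exact key i h.1 j h.2.2 hlt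
  · rintro ⟨i, j⟩ h _ heq
    simp only [mem_sigma, mem_erase] at h
    exact h.2.1 (congrArg Sigma.fst heq)
  · rintro ⟨i, j⟩ h
    simp only [mem_sigma, mem_erase] at h ⊢
    exact ⟨h.2.2, h.2.1.symm, h.1⟩
  · rintro ⟨i, j⟩ h
    rfl

/-! ### The differential in a fixed multidegree -/

variable {σ ι : Type*} [LinearOrder ι] (K : Type*) [Field K] (m : ι → σ →₀ ℕ)

open Classical in
/-- The basis element of multidegree `α` of `Lᵗ` on the symbol `G`; it is `0` if `G` is not an
`L`-admissible symbol of dimension `t`. -/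
noncomputable def gradedSymbol (t : ℕ) (α : σ →₀ ℕ) (G : Finset ι) : LyubeznikModule K m t :=
  if h : G.card = t ∧ LAdmissible m G then
    Finsupp.single ⟨G, h⟩ (MvPolynomial.monomial (α - G.sup m) 1)
  else 0

variable {K m}

theorem gradedSymbol_of_admissible {t : ℕ} (α : σ →₀ ℕ) (F : LSymbol m t) :
    gradedSymbol K m t α F.1 = Finsupp.single F (MvPolynomial.monomial (α - F.1.sup m) 1) := by
  rw [gradedSymbol, dif_pos F.2]

theorem single_monomial_eq_gradedSymbol {t : ℕ} (β : σ →₀ ℕ) (F : LSymbol m t) :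
    (Finsupp.single F (MvPolynomial.monomial β 1) : LyubeznikModule K m t) =
      gradedSymbol K m t (β + F.1.sup m) F.1 := by
  rw [gradedSymbol_of_admissible, add_tsub_cancel_right]

/-- Linearity is only over `K`, because the homotopy below chooses its apex by multidegree and does
not commute with multiplication by variables. -/
theorem addHom_ext_gradedSymbol {t : ℕ} {M : Type*} [AddCommGroup M] [Module K M]
    {f g : LyubeznikModule K m t →ₗ[K] M}
    (h : ∀ (F : LSymbol m t) (α : σ →₀ ℕ), F.1.sup m ≤ α →
      f (gradedSymbol K m t α F.1) = g (gradedSymbol K m t α F.1)) : f = g := by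
  refine Finsupp.lhom_ext' fun F => (MvPolynomial.basisMonomials σ K).ext fun β => ?_
  simpa [single_monomial_eq_gradedSymbol] using h F (β + F.1.sup m) le_add_self

/-- The lcm quotients are absorbed by the multidegree, leaving the simplicial boundary. The bound
`hα` keeps the truncated subtraction exact. -/
theorem lyubeznikDifferential_gradedSymbol {t : ℕ} {α : σ →₀ ℕ} (F : LSymbol m (t + 1))
    (hα : F.1.sup m ≤ α) :
    lyubeznikDifferential K m t (gradedSymbol K m (t + 1) α F.1) =
      ∑ i ∈ F.1, (-1 : ℤ) ^ (F.1.filter (· < i)).card • gradedSymbol K m t α (F.1.erase i) := by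
  rw [gradedSymbol_of_admissible, lyubeznikDifferential, Finsupp.linearCombination_single,
    Finset.smul_sum, ← Finset.sum_attach F.1]
  refine Finset.sum_congr rfl fun i _ => ?_
  have hle : (F.1.erase i.1).sup m ≤ F.1.sup m := Finset.sup_mono (Finset.erase_subset _ _)
  rw [show F.1.erase i.1 = (F.erase i).1 from rfl, gradedSymbol_of_admissible,
    Finsupp.smul_single, Finsupp.smul_single, smul_eq_mul, MvPolynomial.monomial_mul, one_mul,
    show (F.erase i).1 = F.1.erase i.1 from rfl, tsub_add_tsub_cancel hα hle]
  rcases Nat.even_or_odd (F.1.filter (· < i.1)).card with h | h <;>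
    simp [h.neg_one_pow]

theorem lyubeznikDifferential_comp (t : ℕ) (x : LyubeznikModule K m (t + 2)) :
    lyubeznikDifferential K m t (lyubeznikDifferential K m (t + 1) x) = 0 := by
  suffices h : (lyubeznikDifferential K m t).restrictScalars K ∘ₗ
      (lyubeznikDifferential K m (t + 1)).restrictScalars K = 0 from LinearMap.congr_fun h x
  refine addHom_ext_gradedSymbol fun F α hα => ?_
  simp only [LinearMap.comp_apply, LinearMap.restrictScalars_apply, LinearMap.zero_apply]
  rw [lyubeznikDifferential_gradedSymbol F hα, map_sum]
  refine Eq.trans (Finset.sum_congr rfl fun i hi => ?_)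
    (sum_sign_erase_erase (gradedSymbol K m t α) F.1)
  rw [map_zsmul]
  congr 1
  exact lyubeznikDifferential_gradedSymbol (F.erase ⟨i, hi⟩)
    ((Finset.sup_mono (Finset.erase_subset _ _)).trans hα)

/-! ### Exactness by a cone construction -/

variable (K m) in
/-- The contracting homotopy: in multidegree `α` it is the cone construction with apex `q α`. -/
noncomputable def coneHomotopy (q : (σ →₀ ℕ) → ι) (t : ℕ) :
    LyubeznikModule K m t →ₗ[K] LyubeznikModule K m (t + 1) :=
  Finsupp.lsum K fun F : LSymbol m t => (MvPolynomial.basisMonomials σ K).constr K fun β =>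
    if q (β + F.1.sup m) ∈ F.1 then 0 else
      gradedSymbol K m (t + 1) (β + F.1.sup m) (insert (q (β + F.1.sup m)) F.1)

theorem coneHomotopy_gradedSymbol (q : (σ →₀ ℕ) → ι) {t : ℕ} {α : σ →₀ ℕ} (F : LSymbol m t)
    (hα : F.1.sup m ≤ α) :
    coneHomotopy K m q t (gradedSymbol K m t α F.1) =
      if q α ∈ F.1 then 0 else gradedSymbol K m (t + 1) α (insert (q α) F.1) := by
  rw [gradedSymbol_of_admissible, coneHomotopy, Finsupp.lsum_single,
    show MvPolynomial.monomial (α - F.1.sup m) (1 : K) =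
      MvPolynomial.basisMonomials σ K (α - F.1.sup m) by rw [MvPolynomial.coe_basisMonomials],
    Module.Basis.constr_basis, tsub_add_cancel_of_le hα]

/-- At `q`, the lcm involved divides `α`, so a violating index below `q` would contradict
minimality. At a later entry, `q` lies outside the tail and the condition is that of `F`. -/
theorem LAdmissible.insert {α : σ →₀ ℕ} {F : Finset ι} (hF : LAdmissible m F) (hα : F.sup m ≤ α)
    {q : ι} (hq : m q ≤ α) (hmin : ∀ i, m i ≤ α → q ≤ i) : LAdmissible m (insert q F) := by
  have hqF : ∀ i ∈ F, q ≤ i := fun i hi => hmin i ((Finset.le_sup hi).trans hα)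
  rintro i hi ⟨j, hj, hij⟩ r hr hle
  rcases eq_or_ne i q with rfl | hne
  · refine (hmin r (hle.trans ?_)).not_gt hr
    exact (Finset.sup_mono (Finset.filter_subset _ _)).trans (by simp [hq, hα])
  · have hiF : i ∈ F := Finset.mem_of_mem_insert_of_ne hi hne
    have hqi : q < i := lt_of_le_of_ne (hqF i hiF) hne.symm
    refine hF i hiF ⟨j, Finset.mem_of_mem_insert_of_ne hj (hqi.trans hij).ne', hij⟩ r hr ?_
    rwa [Finset.filter_insert, if_neg hqi.not_ge] at hle

/-- If the apex lies in `F`, the homotopy kills every face but the one missing the apex, and coning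
that face restores `F` with sign `+1`, the apex being first. Otherwise the boundary of the cone
contains `F` once, and its other faces cancel against the cone of the boundary, as the apex shifts
every position by one. -/
theorem coneHomotopy_identity {q : (σ →₀ ℕ) → ι} (hq : ∀ α i, m i ≤ α → m (q α) ≤ α ∧ q α ≤ i)
    (t : ℕ) (x : LyubeznikModule K m (t + 1)) :
    lyubeznikDifferential K m (t + 1) (coneHomotopy K m q (t + 1) x) +
      coneHomotopy K m q t (lyubeznikDifferential K m t x) = x := by
  suffices h : (lyubeznikDifferential K m (t + 1)).restrictScalars K ∘ₗ coneHomotopy K m q (t + 1) +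
      coneHomotopy K m q t ∘ₗ (lyubeznikDifferential K m t).restrictScalars K = LinearMap.id from
    LinearMap.congr_fun h x
  refine addHom_ext_gradedSymbol fun F α hα => ?_
  simp only [LinearMap.add_apply, LinearMap.comp_apply, LinearMap.restrictScalars_apply,
    LinearMap.id_apply]
  have hF0 : F.1.Nonempty := Finset.card_pos.mp (by rw [F.2.1]; omega)
  have hmF : ∀ i ∈ F.1, m i ≤ α := fun i hi => (Finset.le_sup hi).trans hα
  have hqα : m (q α) ≤ α := (hq α _ (hmF _ hF0.choose_spec)).1
  have hmin : ∀ i, m i ≤ α → q α ≤ i := fun i hi => (hq α i hi).2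
  have hqF : ∀ i ∈ F.1, q α ≤ i := fun i hi => hmin i (hmF i hi)
  have hh : ∀ i ∈ F.1, coneHomotopy K m q t (gradedSymbol K m t α (F.1.erase i)) =
      if q α ∈ F.1.erase i then 0 else gradedSymbol K m (t + 1) α (insert (q α) (F.1.erase i)) :=
    fun i hi => coneHomotopy_gradedSymbol q (F.erase ⟨i, hi⟩)
      ((Finset.sup_mono (Finset.erase_subset _ _)).trans hα)
  rw [lyubeznikDifferential_gradedSymbol F hα, coneHomotopy_gradedSymbol q F hα, map_sum]
  simp_rw [map_zsmul]
  by_cases hmem : q α ∈ F.1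
  · rw [if_pos hmem, map_zero, zero_add, Finset.sum_eq_single_of_mem _ hmem]
    · rw [hh _ hmem, if_neg (Finset.notMem_erase _ _), Finset.insert_erase hmem,
        Finset.filter_eq_empty_iff.mpr fun i hi => (hqF i hi).not_gt]
      simp
    · intro i hi hne
      rw [hh i hi, if_pos (Finset.mem_erase.mpr ⟨hne.symm, hmem⟩), smul_zero]
  · let F' : LSymbol m (t + 2) := ⟨insert (q α) F.1, by
      rw [Finset.card_insert_of_notMem hmem, F.2.1], F.2.2.insert hα hqα hmin⟩
    have hd := lyubeznikDifferential_gradedSymbol (K := K) (α := α) F'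
      (by simp only [F', Finset.sup_insert]; exact sup_le hqα hα)
    rw [if_neg hmem, hd]
    simp only [F']
    rw [Finset.sum_insert hmem, Finset.erase_insert hmem, Finset.filter_insert,
      if_neg (lt_irrefl _), Finset.filter_eq_empty_iff.mpr fun i hi => (hqF i hi).not_gt,
      Finset.card_empty, pow_zero, one_smul, add_assoc, ← Finset.sum_add_distrib,
      Finset.sum_eq_zero, add_zero]
    intro i hi
    have hlt : q α < i := lt_of_le_of_ne (hqF i hi) fun h => hmem (h ▸ hi)
    rw [hh i hi, if_neg fun h => hmem (Finset.mem_of_mem_erase h), Finset.filter_insert,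
      if_pos hlt, Finset.card_insert_of_notMem (fun h => hmem (Finset.mem_filter.mp h).1),
      Finset.erase_insert_of_ne hlt.ne, ← add_smul]
    convert zero_smul ℤ _ using 2
    ring

theorem lyubeznikDifferential_exact [Finite ι] (t : ℕ) :
    Function.Exact (lyubeznikDifferential K m (t + 1)) (lyubeznikDifferential K m t) := by
  intro x
  refine ⟨fun hx => ?_, ?_⟩
  · rcases isEmpty_or_nonempty ι with hι | ⟨⟨i₀⟩⟩
    · have : IsEmpty (LSymbol m (t + 1)) := ⟨fun F => by
        have := F.2.1
        rw [Finset.eq_empty_of_isEmpty F.1] at this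
        simp at this⟩
      exact ⟨0, Subsingleton.elim _ _⟩
    · have hex : ∀ α : σ →₀ ℕ, ∃ q, ∀ i, m i ≤ α → m q ≤ α ∧ q ≤ i := by
        intro α
        by_cases hne : ({i | m i ≤ α} : Set ι).Nonempty
        · obtain ⟨q, hq, hmin⟩ := Set.exists_min_image _ id (Set.toFinite {i | m i ≤ α}) hne
          exact ⟨q, fun i hi => ⟨hq, hmin i hi⟩⟩
        -- No generator divides `α` here, so the requirement on the apex is vacuous and any index
        -- serves.
        · exact ⟨i₀, fun i hi => (hne ⟨i, hi⟩).elim⟩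
      choose q hq using hex
      refine ⟨coneHomotopy K m q (t + 1) x, ?_⟩
      simpa [hx] using coneHomotopy_identity (K := K) hq t x
  · rintro ⟨y, rfl⟩
    exact lyubeznikDifferential_comp t y

/-! ### The augmentation -/

theorem lyubeznikAugmentation_surjective (I : Ideal (MvPolynomial σ K)) :
    Function.Surjective (lyubeznikAugmentation m I) := by
  intro y
  obtain ⟨p, rfl⟩ := Ideal.Quotient.mk_surjective y
  refine ⟨Finsupp.single ⟨∅, rfl, by simp [LAdmissible]⟩ p, ?_⟩
  rw [lyubeznikAugmentation, Finsupp.linearCombination_single]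
  exact congrArg (Ideal.Quotient.mk I) (mul_one p)

theorem lyubeznikAugmentation_exact {I : Ideal (MvPolynomial σ K)}
    (hI : I = Ideal.span (Set.range fun i => MvPolynomial.monomial (m i) (1 : K))) :
    Function.Exact (lyubeznikDifferential K m 0) (lyubeznikAugmentation m I) := by
  let e : LSymbol m 0 := ⟨∅, rfl, by simp [LAdmissible]⟩
  have he : ∀ F : LSymbol m 0, F = e := fun F => Subtype.ext (Finset.card_eq_zero.mp F.2.1)
  have hx : ∀ x : LyubeznikModule K m 0, x = Finsupp.single e (x e) := fun x => by
    ext F : 1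
    rw [he F, Finsupp.single_eq_same]
  have haug : ∀ p, lyubeznikAugmentation m I (Finsupp.single e p) = Ideal.Quotient.mk I p :=
    fun p => by
      rw [lyubeznikAugmentation, Finsupp.linearCombination_single]
      exact congrArg (Ideal.Quotient.mk I) (mul_one p)
  -- Every singleton is admissible, since the last entry of a symbol is exempt from the condition;
  -- hence the image of `L¹` reaches all generators.
  let s : ι → LSymbol m 1 := fun i => ⟨{i}, by simp, by
    rintro j hj ⟨k, hk, hjk⟩
    rw [Finset.mem_singleton.mp hj, Finset.mem_singleton.mp hk] at hjk
    exact (lt_irrefl _ hjk).elim⟩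
  have hs : ∀ F : LSymbol m 1, ∃ i, F = s i := fun F => by
    obtain ⟨i, hi⟩ := Finset.card_eq_one.mp F.2.1
    exact ⟨i, Subtype.ext hi⟩
  have hd : ∀ i, lyubeznikDifferential K m 0 (Finsupp.single (s i) 1) =
      Finsupp.single e (MvPolynomial.monomial (m i) 1) := fun i => by
    have h := lyubeznikDifferential_gradedSymbol (K := K) (s i) le_rfl
    rw [gradedSymbol_of_admissible] at h
    have h0 := gradedSymbol_of_admissible (K := K) (m i) e
    simpa [s, e, Finset.filter_singleton, h0, bot_eq_zero] using h
  rw [LinearMap.exact_iff]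
  refine le_antisymm ?_ ?_
  · intro x hx0
    rw [LinearMap.mem_ker, hx x, haug, Ideal.Quotient.eq_zero_iff_mem, hI] at hx0
    have hle : Ideal.span (Set.range fun i => MvPolynomial.monomial (m i) (1 : K)) ≤
        (LinearMap.range (lyubeznikDifferential K m 0)).comap (Finsupp.lsingle e) := by
      refine Ideal.span_le.mpr ?_
      rintro _ ⟨i, rfl⟩
      exact ⟨_, hd i⟩
    rw [hx x]
    exact hle hx0
  · rw [LinearMap.range_le_ker_iff]
    refine Finsupp.lhom_ext' fun F => LinearMap.ext_ring ?_
    obtain ⟨i, rfl⟩ := hs F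
    simp only [LinearMap.comp_apply, Finsupp.lsingle_apply, hd, haug, LinearMap.zero_apply,
      Ideal.Quotient.eq_zero_iff_mem]
    exact hI ▸ Ideal.subset_span ⟨i, rfl⟩

/-! ### Minimality criterion -/

theorem monomial_mem_span_range_X {s : σ →₀ ℕ} (hs : s ≠ 0) (c : K) :
    MvPolynomial.monomial s c ∈
      Ideal.span (Set.range (MvPolynomial.X : σ → MvPolynomial σ K)) := by
  obtain ⟨i, hi⟩ := Finsupp.ne_iff.mp hs
  rw [← Set.image_univ, MvPolynomial.mem_ideal_span_X_image]
  intro u hu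
  have := MvPolynomial.support_monomial_subset hu
  rw [Finset.mem_singleton] at this
  exact ⟨i, trivial, this ▸ hi⟩

/-- A matrix entry is a unit only if its exponent vanishes, that is, if `m i` divides the lcm of the
other entries of `F`. -/
theorem lyubeznikDifferential_range_le
    (hm : ∀ F : Finset ι, LAdmissible m F → ∀ i ∈ F, ¬ m i ≤ (F.erase i).sup m) (t : ℕ) :
    LinearMap.range (lyubeznikDifferential K m t) ≤
      Ideal.span (Set.range (MvPolynomial.X : σ → MvPolynomial σ K)) •
        (⊤ : Submodule (MvPolynomial σ K) (LyubeznikModule K m t)) := by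
  rw [lyubeznikDifferential, Finsupp.range_linearCombination, Submodule.span_le]
  rintro _ ⟨F, rfl⟩
  refine Submodule.sum_mem _ fun i _ => ?_
  rw [← mul_one (MvPolynomial.monomial _ _), ← smul_eq_mul, ← Finsupp.smul_single]
  refine Submodule.smul_mem_smul (monomial_mem_span_range_X (fun h => ?_) _) trivial
  exact hm F.1 F.2.2 i.1 i.2 ((Finset.le_sup i.2).trans (tsub_eq_zero_iff_le.mp h))

theorem isMinimalFreeResolution_lyubeznik [Finite ι] {I : Ideal (MvPolynomial σ K)}
    (hI : I = Ideal.span (Set.range fun i => MvPolynomial.monomial (m i) (1 : K)))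
    (hm : ∀ F : Finset ι, LAdmissible m F → ∀ i ∈ F, ¬ m i ≤ (F.erase i).sup m) :
    IsMinimalFreeResolution (Ideal.span (Set.range (MvPolynomial.X : σ → MvPolynomial σ K)))
      (lyubeznikDifferential K m) (lyubeznikAugmentation m I) where
  free _ := inferInstance
  finite _ := inferInstance
  exact_succ := lyubeznikDifferential_exact
  exact_zero := lyubeznikAugmentation_exact hI
  surjective := lyubeznikAugmentation_surjective I
  minimal := lyubeznikDifferential_range_le hm

end Exactness

/-! ### Edge ideals -/

section EdgeIdeals

theorem IsMonomialIdeal.eq_span_minimalGenerators {σ K : Type*} [Field K]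
    {I : Ideal (MvPolynomial σ K)} (hI : IsMonomialIdeal I) :
    I = Ideal.span (Set.range fun s : minimalGenerators I =>
      MvPolynomial.monomial s.1 (1 : K)) := by
  refine le_antisymm ?_ (Ideal.span_le.mpr ?_)
  · obtain ⟨S, hS⟩ := hI
    conv_lhs => rw [hS]
    refine Ideal.span_le.mpr ?_
    rintro _ ⟨s, hs, rfl⟩
    have hsI : MvPolynomial.monomial s (1 : K) ∈ I := hS ▸ Ideal.subset_span ⟨s, hs, rfl⟩
    obtain ⟨r, hrs, hr⟩ := exists_minimal_le_of_wellFoundedLT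
      (fun s => MvPolynomial.monomial s (1 : K) ∈ I) s hsI
    have hmul : MvPolynomial.monomial s (1 : K) =
        MvPolynomial.monomial (s - r) 1 * MvPolynomial.monomial r 1 := by
      rw [MvPolynomial.monomial_mul, one_mul, tsub_add_cancel_of_le hrs]
    simp only [SetLike.mem_coe]
    rw [hmul]
    exact Ideal.mul_mem_left _ _ (Ideal.subset_span ⟨⟨r, hr⟩, rfl⟩)
  · rintro _ ⟨s, rfl⟩
    exact Minimal.prop (P := fun s => MvPolynomial.monomial s (1 : K) ∈ I) s.2

variable (K : Type*) [Field K] {V : Type*} (G : SimpleGraph V)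

/-- The exponent vectors of the products `x_a x_b` with `{a, b}` an edge of `G`. -/
def edgeExponents : Set (V →₀ ℕ) :=
  {s | ∃ a b : V, G.Adj a b ∧ s = Finsupp.single a 1 + Finsupp.single b 1}

theorem edgeIdeal_eq_span_monomial :
    edgeIdeal K G =
      Ideal.span ((fun s => MvPolynomial.monomial s (1 : K)) '' edgeExponents G) := by
  rw [edgeIdeal]
  congr 1
  ext f
  constructor
  · rintro ⟨a, b, hab, rfl⟩
    refine ⟨_, ⟨a, b, hab, rfl⟩, ?_⟩
    simp [MvPolynomial.X, MvPolynomial.monomial_mul]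
  · rintro ⟨_, ⟨a, b, hab, rfl⟩, rfl⟩
    refine ⟨a, b, hab, ?_⟩
    simp [MvPolynomial.X, MvPolynomial.monomial_mul]

theorem isMonomialIdeal_edgeIdeal : IsMonomialIdeal (edgeIdeal K G) :=
  ⟨_, edgeIdeal_eq_span_monomial K G⟩

/-- A monomial of the ideal is divisible by some edge monomial, and minimality forces equality. This
inclusion suffices to make the generators finite in number and to read each as an edge. -/
theorem minimalGenerators_edgeIdeal_subset :
    minimalGenerators (edgeIdeal K G) ⊆ edgeExponents G := by
  intro s hs
  have hmin : Minimal (fun s => MvPolynomial.monomial s (1 : K) ∈ edgeIdeal K G) s := hs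
  have hmem := hmin.prop
  rw [edgeIdeal_eq_span_monomial, MvPolynomial.mem_ideal_span_monomial_image] at hmem
  obtain ⟨r, hr, hrs⟩ := hmem s (by classical simp [MvPolynomial.coeff_monomial])
  have hrI : MvPolynomial.monomial r (1 : K) ∈ edgeIdeal K G := by
    rw [edgeIdeal_eq_span_monomial]
    exact Ideal.subset_span ⟨r, hr, rfl⟩
  rwa [le_antisymm (hmin.le_of_le hrI hrs) hrs]

theorem finite_edgeExponents [Finite V] : (edgeExponents G).Finite := by
  refine (Set.finite_range fun p : V × V =>
    (Finsupp.single p.1 1 + Finsupp.single p.2 1 : V →₀ ℕ)).subset ?_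
  rintro _ ⟨a, b, _, rfl⟩
  exact ⟨(a, b), rfl⟩

variable {G}

theorem exists_edge_of_mem_edgeExponents {s : V →₀ ℕ} (hs : s ∈ edgeExponents G) {a : V}
    (ha : 1 ≤ s a) : ∃ c, G.Adj a c ∧ s = Finsupp.single a 1 + Finsupp.single c 1 := by
  classical
  obtain ⟨b, c, hbc, rfl⟩ := hs
  rw [Finsupp.add_apply, Finsupp.single_apply, Finsupp.single_apply] at ha
  split_ifs at ha with h1 h2 h2
  · exact (hbc.ne (h1.trans h2.symm)).elim
  · exact ⟨c, h1 ▸ hbc, by rw [h1]⟩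
  · exact ⟨b, h2 ▸ hbc.symm, by rw [h2, add_comm]⟩
  · omega

theorem exists_mem_one_le_of_le_sup {ι : Type*} {m : ι → V →₀ ℕ} {F : Finset ι} {a : V}
    (h : 1 ≤ F.sup m a) : ∃ i ∈ F, 1 ≤ m i a := by
  by_contra! hcon
  -- If `a` occurs in no `m i`, lowering the exponent of `a` still leaves an upper bound, which is
  -- absurd at `a`.
  have hle : F.sup m ≤ F.sup m - Finsupp.single a 1 := by
    refine Finset.sup_le fun i hi v => ?_
    by_cases hv : v = a
    · subst hv
      have := hcon i hi
      omega
    · rw [Finsupp.tsub_apply, Finsupp.single_eq_of_ne hv, tsub_zero]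
      exact Finset.le_sup (f := m) hi v
  have := hle a
  rw [Finsupp.tsub_apply, Finsupp.single_eq_same] at this
  omega

theorem LAdmissible.not_le_sup_erase {ι : Type*} [LinearOrder ι] {m : ι → V →₀ ℕ}
    (hinj : Function.Injective m) (hedge : ∀ i, m i ∈ edgeExponents G)
    (hG : ∀ (u v : V) (p : G.Walk u v), p.IsPath → ¬ 3 ≤ p.length)
    {F : Finset ι} (hF : LAdmissible m F) {i : ι} (hi : i ∈ F) :
    ¬ m i ≤ (F.erase i).sup m := by
  classical
  intro hle
  obtain ⟨a, b, hab, hiab⟩ := hedge i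
  have hia : 1 ≤ m i a := by simp [hiab]
  have hib : 1 ≤ m i b := by simp [hiab]
  obtain ⟨j, hj, hja⟩ := exists_mem_one_le_of_le_sup (hia.trans (hle a))
  obtain ⟨k, hk, hkb⟩ := exists_mem_one_le_of_le_sup (hib.trans (hle b))
  obtain ⟨c, hac, hjac⟩ := exists_edge_of_mem_edgeExponents (hedge j) hja
  obtain ⟨d, hbd, hkbd⟩ := exists_edge_of_mem_edgeExponents (hedge k) hkb
  rw [Finset.mem_erase] at hj hk
  have hcb : c ≠ b := by
    rintro rfl
    exact hj.1 (hinj (hjac.trans hiab.symm))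
  have hda : d ≠ a := by
    rintro rfl
    exact hk.1 (hinj (hkbd.trans (by rw [hiab, add_comm])))
  -- Otherwise `c, a, b, d` is a path of length 3.
  obtain rfl : c = d := by
    by_contra hcd
    refine hG c d (.cons hac.symm (.cons hab (.cons hbd .nil))) ?_ le_rfl
    simp [SimpleGraph.Walk.cons_isPath_iff, hac.ne', hcb, hcd, hab.ne, hda.symm, hbd.ne]
  have hjk : j ≠ k := by
    rintro rfl
    have := DFunLike.congr_fun (hjac.symm.trans hkbd) a
    simp [hab.ne', hac.ne'] at this
  -- Admissibility at the smaller of `p` and `q`: the tail starting there contains both.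
  have key : ∀ p ∈ F, ∀ q ∈ F, ∀ r, r < p → r < q → p ≠ q → ¬ m r ≤ m p ⊔ m q := by
    have aux : ∀ p ∈ F, ∀ q ∈ F, ∀ r, r < p → p < q → ¬ m r ≤ m p ⊔ m q := by
      intro p hp q hq r hrp hpq h
      refine hF p hp ⟨q, hq, hpq⟩ r hrp (h.trans (sup_le ?_ ?_))
      · exact Finset.le_sup (f := m) (by simp [hp])
      · exact Finset.le_sup (f := m) (by simp [hq, hpq.le])
    intro p hp q hq r hrp hrq hpq h
    rcases lt_or_gt_of_ne hpq with hlt | hlt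
    · exact aux p hp q hq r hrp hlt h
    · exact aux q hq p hp r hrq hlt (by rwa [sup_comm])
  have tri : ∀ x y z : V, x ≠ y →
      (Finsupp.single x 1 + Finsupp.single y 1 : V →₀ ℕ) ≤
        (Finsupp.single x 1 + Finsupp.single z 1) ⊔
          (Finsupp.single y 1 + Finsupp.single z 1) := by
    intro x y z hxy v
    simp only [Finsupp.sup_apply, Finsupp.add_apply, Finsupp.single_apply]
    split_ifs <;> simp_all
  have hcomm : ∀ x y : V →₀ ℕ, x + y = y + x := add_comm
  have h1 : m i ≤ m j ⊔ m k := by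
    rw [hiab, hjac, hkbd]; exact tri a b c hab.ne
  have h2 : m j ≤ m i ⊔ m k := by
    rw [hiab, hjac, hkbd, hcomm (Finsupp.single b 1) (Finsupp.single c 1)]; exact tri a c b hac.ne
  have h3 : m k ≤ m i ⊔ m j := by
    rw [hiab, hjac, hkbd, hcomm (Finsupp.single a 1) (Finsupp.single b 1),
      hcomm (Finsupp.single a 1) (Finsupp.single c 1)]
    exact tri b c a hbd.ne
  -- The least of `i`, `j`, `k` plays the role of `r` in `key`; the two cyclic, impossible sign
  -- patterns are closed by the same argument.
  rcases lt_or_gt_of_ne hj.1 with hji | hji <;> rcases lt_or_gt_of_ne hk.1 with hki | hki <;>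
    rcases lt_or_gt_of_ne hjk with hjk' | hjk'
  · exact key i hi k hk.2 j hji hjk' hk.1.symm h2
  · exact key i hi j hj.2 k hki hjk' hj.1.symm h3
  · exact key i hi k hk.2 j hji hjk' hk.1.symm h2
  · exact key i hi j hj.2 k (hjk'.trans hji) hjk' hj.1.symm h3
  · exact key i hi k hk.2 j (hjk'.trans hki) hjk' hk.1.symm h2
  · exact key i hi j hj.2 k hki hjk' hj.1.symm h3
  · exact key j hj.2 k hk.2 i hji hki hjk h1
  · exact key j hj.2 k hk.2 i hji hki hjk h1

theorem isLyubeznikTotallyIdeal_edgeIdeal [Finite V]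
    (hG : ∀ (u v : V) (p : G.Walk u v), p.IsPath → ¬ 3 ≤ p.length) :
    IsLyubeznikTotallyIdeal (edgeIdeal K G) := by
  have hfin : Finite (minimalGenerators (edgeIdeal K G)) :=
    ((finite_edgeExponents G).subset (minimalGenerators_edgeIdeal_subset K G)).to_subtype
  have hall : ∀ ord : LinearOrder (minimalGenerators (edgeIdeal K G)),
      LyubeznikResolutionIsMinimal (edgeIdeal K G) ord := fun ord =>
    isMinimalFreeResolution_lyubeznik (isMonomialIdeal_edgeIdeal K G).eq_span_minimalGenerators
      fun _ hF _ hi => hF.not_le_sup_erase Subtype.val_injective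
        (fun s => minimalGenerators_edgeIdeal_subset K G s.2) hG hi
  obtain ⟨ord⟩ : Nonempty (LinearOrder (minimalGenerators (edgeIdeal K G))) :=
    by classical exact ⟨linearOrderOfSTO WellOrderingRel⟩
  exact ⟨⟨isMonomialIdeal_edgeIdeal K G, ord, hall ord⟩, hall⟩

/-- Such a path has at least four distinct vertices, each an endpoint of one of its edges and hence
among `a`, `b`, `c`. -/
theorem not_three_le_length_of_edgeSet_eq_triangle {a b c : V}
    (h : G.edgeSet = {s(a, b), s(b, c), s(a, c)}) (u v : V) (p : G.Walk u v) (hp : p.IsPath) :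
    ¬ 3 ≤ p.length := by
  classical
  intro hlen
  have hnil : ¬ p.Nil := fun hn => by
    rw [← SimpleGraph.Walk.length_eq_zero_iff] at hn
    omega
  have hsub : p.support.toFinset ⊆ {a, b, c} := by
    intro x hx
    rw [List.mem_toFinset, SimpleGraph.Walk.mem_support_iff_exists_mem_edges_of_not_nil hnil] at hx
    obtain ⟨e, he, hxe⟩ := hx
    have := p.edges_subset_edgeSet he
    rw [h] at this
    rcases this with rfl | rfl | rfl <;> rw [Sym2.mem_iff] at hxe <;>
      rcases hxe with rfl | rfl <;> simp
  have hcard := Finset.card_le_card hsub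
  rw [List.toFinset_card_of_nodup hp.support_nodup, SimpleGraph.Walk.length_support] at hcard
  have := Finset.card_le_three (a := a) (b := b) (c := c)
  omega

end EdgeIdeals

theorem mainTheorem10 (K : Type*) [Field K] (V : Type*) [Finite V] (G : SimpleGraph V) :
    ((∀ (u v : V) (p : G.Walk u v), p.IsPath → ¬ 3 ≤ p.length) →
      IsLyubeznikTotallyIdeal (edgeIdeal K G)) ∧
    ((∃ a b c : V, a ≠ b ∧ b ≠ c ∧ a ≠ c ∧ G.edgeSet = {s(a, b), s(b, c), s(a, c)}) →
      IsLyubeznikTotallyIdeal (edgeIdeal K G)) := by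
  refine ⟨isLyubeznikTotallyIdeal_edgeIdeal K, ?_⟩
  rintro ⟨a, b, c, -, -, -, h⟩
  exact isLyubeznikTotallyIdeal_edgeIdeal K (not_three_le_length_of_edgeSet_eq_triangle h)
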